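/- Let $\langle \psi_e : e\in\omega\rangle$ be an acceptable numbering (in the sense of Rogers) of the unary partial computable functions on $\omega$, that is, one for which there are computable functions $f,g:\omega\to\omega$ with $\psi_e=\varphi_{f(e)}$ and $\varphi_e=\psi_{g(e)}$ for all $e$, where $\langle\varphi_e : e\in\omega\rangle$ is the standard numbering. Let $W_e$ be the domain of $\psi_e$. A nonempty computably enumerable set $A\subseteq\omega$ is called self-constructing if $W_e=A$ for every $e\in A$. Then the index set $$S=\{e\in\omega : W_e \text{ is self-constructing}\}$$ is $\Pi^0_2$-complete: $S$ is $\Pi^0_2$ (there is a computable relation $R\subseteq\omega^3$ such that $e\in S\iff \forall x\,\exists y\;R(e,x,y)$ for all $e$), and every $\Pi^0_2$ set $B\subseteq\omega$ is many-one reducible to $S$. In particular, $\mathrm{Tot}=\{e\in\omega : W_e=\omega\}$ is many-one reducible to $S$. -/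

import Mathlib

namespace SelfConstructing

/-- The standard numbering of the unary partial computable functions: `stdNumbering e` is the
function computed by the program with code number `e`. -/
def stdNumbering (e : ℕ) : ℕ →. ℕ :=
  Nat.Partrec.Code.eval (Denumerable.ofNat Nat.Partrec.Code e)

/-- Acceptable numberings of the unary partial computable functions, in the sense of Rogers:
indices can be translated computably to and from the indices of the standard numbering. -/
def IsAcceptable (ψ : ℕ → ℕ →. ℕ) : Prop :=
  (∃ f : ℕ → ℕ, Computable f ∧ ∀ e, ψ e = stdNumbering (f e)) ∧
    ∃ g : ℕ → ℕ, Computable g ∧ ∀ e, stdNumbering e = ψ (g e)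

theorem isAcceptable_stdNumbering : IsAcceptable stdNumbering :=
  ⟨⟨id, Computable.id, fun _ => rfl⟩, ⟨id, Computable.id, fun _ => rfl⟩⟩

/-- `W ψ e` is the domain of the `e`-th partial computable function. -/
def W (ψ : ℕ → ℕ →. ℕ) (e : ℕ) : Set ℕ := (ψ e).Dom

/-- A nonempty computably enumerable set `A` is self-constructing if every element of `A` is
an index of `A`. -/
def IsSelfConstructing (ψ : ℕ → ℕ →. ℕ) (A : Set ℕ) : Prop :=
  A.Nonempty ∧ REPred (fun n => n ∈ A) ∧ ∀ e ∈ A, W ψ e = A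

/-- The index set of the self-constructing sets. -/
def S (ψ : ℕ → ℕ →. ℕ) : Set ℕ := {e | IsSelfConstructing ψ (W ψ e)}

/-- The index set of the set of all natural numbers. -/
def Tot (ψ : ℕ → ℕ →. ℕ) : Set ℕ := {e | W ψ e = Set.univ}

/-- `A` is `Π⁰₂`: membership of `n` in `A` has the form `∀ x, ∃ y, R n x y` with a computable
relation `R`. -/
def IsPi02 (A : Set ℕ) : Prop :=
  ∃ R : ℕ → ℕ → ℕ → Prop,
    ComputablePred (fun p : ℕ × ℕ × ℕ => R p.1 p.2.1 p.2.2) ∧ ∀ n, n ∈ A ↔ ∀ x, ∃ y, R n x y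

/-- `A` is `Π⁰₂`-complete: it is `Π⁰₂` and every `Π⁰₂` set is many-one reducible to it. -/
def IsPi02Complete (A : Set ℕ) : Prop :=
  IsPi02 A ∧ ∀ B : Set ℕ, IsPi02 B → ManyOneReducible (fun n => n ∈ B) (fun n => n ∈ A)

end SelfConstructing

namespace SelfConstructing

open Nat.Partrec (Code)
open Encodable Denumerable

/-! Upper bound: nonemptiness is Σ⁰₁, and `W a = W e` for all `a ∈ W e` amounts to implications
between c.e. conditions, which are Π⁰₂ (`isPi02_S`). Hardness: given `B = {n | ∀ x, ∃ y, R n x y}`,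
the recursion theorem (`exists_indices`) yields a family of indices `p n i` whose sets are either
the whole family `{p n j | j}` or empty. Index `0` always gets the whole family, index `x + 1` only
once some `y` with `R n x y` is found. So `W (p n 0)` is self-constructing iff no member of the
family has an empty set, i.e. iff `n ∈ B`. -/

/-- For an acceptable numbering, the relation `x ∈ W ψ e` is the projection of a decidable
relation. -/
theorem IsAcceptable.exists_stages {ψ : ℕ → ℕ →. ℕ} (hψ : IsAcceptable ψ) :
    ∃ D : ℕ × ℕ × ℕ → Bool, Computable D ∧ ∀ e x, x ∈ W ψ e ↔ ∃ t, D (e, x, t) = true := by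
  obtain ⟨⟨f, hf, hψf⟩, -⟩ := hψ
  refine ⟨fun p => (Code.evaln p.2.2 (ofNat Code (f p.1)) p.2.1).isSome, ?_, fun e x => ?_⟩
  · exact Primrec.option_isSome.to_comp.comp <| Code.primrec_evaln.to_comp.comp <|
      ((Computable.snd.comp Computable.snd).pair
        ((Computable.ofNat Code).comp (hf.comp Computable.fst))).pair
        (Computable.fst.comp Computable.snd)
  · simp only [W, hψf, stdNumbering, PFun.mem_dom, Code.evaln_complete, Option.isSome_iff_exists]
    exact exists_comm

theorem IsAcceptable.rePred_W {ψ : ℕ → ℕ →. ℕ} (hψ : IsAcceptable ψ) (e : ℕ) :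
    REPred (fun n => n ∈ W ψ e) := by
  obtain ⟨⟨f, -, hψf⟩, -⟩ := hψ
  have h : Partrec (ψ e) := by
    rw [hψf]
    exact Code.eval_part.comp (Computable.const (ofNat Code (f e))) Computable.id
  exact h.dom_re

theorem IsPi02.of_bool {A : Set ℕ} (R : ℕ × ℕ × ℕ → Bool) (hR : Computable R)
    (hA : ∀ n, n ∈ A ↔ ∀ x, ∃ y, R (n, x, y) = true) : IsPi02 A :=
  ⟨fun n x y => R (n, x, y) = true, ⟨inferInstance, by simpa using hR⟩, hA⟩

theorem IsPi02.exists_bool {A : Set ℕ} (hA : IsPi02 A) :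
    ∃ R : ℕ × ℕ × ℕ → Bool, Computable R ∧ ∀ n, n ∈ A ↔ ∀ x, ∃ y, R (n, x, y) = true := by
  obtain ⟨R, ⟨_, hR⟩, hA⟩ := hA
  exact ⟨_, hR, fun n => by simp [hA]⟩

theorem isPi02_Tot {ψ : ℕ → ℕ →. ℕ} (hψ : IsAcceptable ψ) : IsPi02 (Tot ψ) := by
  obtain ⟨D, hD, hW⟩ := hψ.exists_stages
  exact .of_bool D hD fun e => by simp [Tot, Set.eq_univ_iff_forall, hW]

/-- The c.e. clause is automatic for sets of the form `W ψ e`. -/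
theorem mem_S_iff {ψ : ℕ → ℕ →. ℕ} (hψ : IsAcceptable ψ) {e : ℕ} :
    e ∈ S ψ ↔ (W ψ e).Nonempty ∧ ∀ a ∈ W ψ e, W ψ a = W ψ e :=
  ⟨fun h => ⟨h.1, h.2.2⟩, fun h => ⟨h.1, hψ.rePred_W e, h.2⟩⟩

theorem isPi02_S {ψ : ℕ → ℕ →. ℕ} (hψ : IsAcceptable ψ) : IsPi02 (S ψ) := by
  obtain ⟨D, hD, hW⟩ := hψ.exists_stages
  let l : ℕ → ℕ := fun z => z.unpair.1
  let r : ℕ → ℕ := fun z => z.unpair.2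
  have hl : Computable l := Computable.fst.comp Computable.unpair
  have hr : Computable r := Computable.snd.comp Computable.unpair
  -- `z` codes `a, x, s₁, s₂, s₃`, and `y` codes `b, t, u, v`.
  let T : ℕ → ℕ → ℕ → Bool := fun e x s => D (e, x, s)
  have hT {i j k : ℕ × ℕ × ℕ → ℕ} (hi : Computable i) (hj : Computable j) (hk : Computable k) :
      Computable fun p => T (i p) (j p) (k p) := hD.comp (hi.pair (hj.pair hk))
  have hand {b c : ℕ × ℕ × ℕ → Bool} (hb : Computable b) (hc : Computable c) :
      Computable fun p => b p && c p := Primrec.and.to_comp.comp hb hc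
  have himp {b c : ℕ × ℕ × ℕ → Bool} (hb : Computable b) (hc : Computable c) :
      Computable fun p => !b p || c p :=
    Primrec.or.to_comp.comp (Primrec.not.to_comp.comp hb) hc
  have c1 : Computable fun p : ℕ × ℕ × ℕ => p.1 := Computable.fst
  have c2 : Computable fun p : ℕ × ℕ × ℕ => p.2.1 := Computable.fst.comp Computable.snd
  have c3 : Computable fun p : ℕ × ℕ × ℕ => p.2.2 := Computable.snd.comp Computable.snd
  have ca := hl.comp (hl.comp c2)
  have cx := hr.comp (hl.comp c2)
  have cs := hl.comp (hr.comp c2)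
  have cs' := hr.comp (hr.comp c2)
  have cb := hl.comp (hl.comp c3)
  have ct := hr.comp (hl.comp c3)
  have cu := hr.comp c3
  -- Stage `t` certifies `b ∈ W e`; `u` and `v` serve the two inclusions between `W e` and `W a`.
  -- One stage for `x` serves as premise in both, since `z` ranges over all codes.
  refine .of_bool (fun p =>
    T p.1 (l (l p.2.2)) (r (l p.2.2)) &&
      ((!(T p.1 (l (l p.2.1)) (l (r p.2.1)) && T p.1 (r (l p.2.1)) (r (r p.2.1))) ||
          T (l (l p.2.1)) (r (l p.2.1)) (l (r p.2.2))) &&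
        (!(T p.1 (l (l p.2.1)) (l (r p.2.1)) && T (l (l p.2.1)) (r (l p.2.1)) (r (r p.2.1))) ||
          T p.1 (r (l p.2.1)) (r (r p.2.2)))))
    (hand (hT c1 cb ct) (hand
      (himp (hand (hT c1 ca cs) (hT c1 cx cs')) (hT ca cx (hl.comp cu)))
      (himp (hand (hT c1 ca cs) (hT ca cx cs')) (hT c1 cx (hr.comp cu))))) fun e => ?_
  have hW' : ∀ e x, x ∈ W ψ e ↔ ∃ t, T e x t = true := hW
  have himp' (b c : Bool) : (!b || c) = true ↔ (b = true → c = true) := by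
    cases b <;> simp
  simp only [Bool.and_eq_true, himp']
  rw [mem_S_iff hψ]
  constructor
  · rintro ⟨⟨b, hb⟩, h⟩ z
    obtain ⟨t, ht⟩ := (hW' e b).1 hb
    -- If the premise fails, any stage works, so `0` is taken.
    have h₁ : ∃ u, (T e (l (l z)) (l (r z)) = true ∧ T e (r (l z)) (r (r z)) = true) →
        T (l (l z)) (r (l z)) u = true := by
      by_cases hc : T e (l (l z)) (l (r z)) = true ∧ T e (r (l z)) (r (r z)) = true
      · have hx := (hW' _ _).2 ⟨_, hc.2⟩
        rw [← h _ ((hW' _ _).2 ⟨_, hc.1⟩)] at hx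
        exact ((hW' _ _).1 hx).imp fun _ hu _ => hu
      · exact ⟨0, fun h => absurd h hc⟩
    have h₂ : ∃ v, (T e (l (l z)) (l (r z)) = true ∧ T (l (l z)) (r (l z)) (r (r z)) = true) →
        T e (r (l z)) v = true := by
      by_cases hc : T e (l (l z)) (l (r z)) = true ∧ T (l (l z)) (r (l z)) (r (r z)) = true
      · have hx := (hW' _ _).2 ⟨_, hc.2⟩
        rw [h _ ((hW' _ _).2 ⟨_, hc.1⟩)] at hx
        exact ((hW' _ _).1 hx).imp fun _ hv _ => hv
      · exact ⟨0, fun h => absurd h hc⟩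
    obtain ⟨u, hu⟩ := h₁
    obtain ⟨v, hv⟩ := h₂
    refine ⟨Nat.pair (Nat.pair b t) (Nat.pair u v), ?_⟩
    simpa [l, r] using ⟨ht, by simpa [l, r] using hu, by simpa [l, r] using hv⟩
  · intro h
    refine ⟨?_, fun a ha => ?_⟩
    · obtain ⟨y, hy, -⟩ := h 0
      exact ⟨_, (hW' _ _).2 ⟨_, hy⟩⟩
    · obtain ⟨s, hs⟩ := (hW' _ _).1 ha
      ext x
      constructor <;> intro hx <;> obtain ⟨s', hs'⟩ := (hW' _ _).1 hx <;>
        obtain ⟨y, -, h₁, h₂⟩ := h (Nat.pair (Nat.pair a x) (Nat.pair s s'))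
      · simp only [l, r, Nat.unpair_pair] at h₂
        exact (hW' _ _).2 ⟨_, h₂ ⟨hs, hs'⟩⟩
      · simp only [l, r, Nat.unpair_pair] at h₁
        exact (hW' _ _).2 ⟨_, h₁ ⟨hs, hs'⟩⟩

/-- By the recursion theorem, there are uniformly computable indices `p n i` such that the set with
index `p n i` is `{p n j | j : ℕ}` if `Q (n, i, y)` holds for some `y`, and is empty otherwise. -/
theorem IsAcceptable.exists_indices {ψ : ℕ → ℕ →. ℕ} (hψ : IsAcceptable ψ)
    {Q : ℕ × ℕ × ℕ → Bool} (hQ : Computable Q) :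
    ∃ p : ℕ → ℕ → ℕ, Computable₂ p ∧
      ∀ n i m, m ∈ W ψ (p n i) ↔ (∃ y, Q (n, i, y) = true) ∧ m ∈ Set.range (p n) := by
  obtain ⟨-, g, hg, hψg⟩ := hψ
  -- `w` codes `((n, i), m)` and `k` codes `(y, j)`. The search halts iff some `y` satisfies `Q` and
  -- `m` is the `j`-th index built from the program's own code `c`.
  let F : Code → ℕ →. ℕ := fun c w => Nat.rfind fun k => Part.some
    (Q (w.unpair.1.unpair.1, w.unpair.1.unpair.2, k.unpair.1) &&
      decide (w.unpair.2 =
        g (encode (Code.curry c (Nat.pair w.unpair.1.unpair.1 k.unpair.2)))))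
  have hF : Partrec₂ F := by
    have hl : Computable fun z : ℕ => z.unpair.1 := Computable.fst.comp Computable.unpair
    have hr : Computable fun z : ℕ => z.unpair.2 := Computable.snd.comp Computable.unpair
    have hc : Computable fun a : (Code × ℕ) × ℕ => a.1.1 := Computable.fst.comp Computable.fst
    have hw : Computable fun a : (Code × ℕ) × ℕ => a.1.2 := Computable.snd.comp Computable.fst
    have hk : Computable fun a : (Code × ℕ) × ℕ => a.2 := Computable.snd
    have hn := hl.comp (hl.comp hw)
    have hp := hg.comp (Computable.encode.comp (Code.primrec₂_curry.to_comp.comp hc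
      (Primrec₂.natPair.to_comp.comp hn (hr.comp hk))))
    refine Partrec.rfind (Computable.partrec ?_)
    exact Primrec.and.to_comp.comp (hQ.comp (hn.pair ((hr.comp (hl.comp hw)).pair (hl.comp hk))))
      ((Primrec.eq (α := ℕ)).decide.to_comp.comp (hr.comp hw) hp)
  obtain ⟨c, hc⟩ := Code.fixed_point₂ hF
  refine ⟨fun n i => g (encode (Code.curry c (Nat.pair n i))), ?_, fun n i m => ?_⟩
  · exact hg.comp (Computable.encode.comp (Code.primrec₂_curry.to_comp.comp
      (Computable.const c) (Primrec₂.natPair.to_comp.comp Computable.fst Computable.snd)))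
  · have hdom : m ∈ W ψ (g (encode (Code.curry c (Nat.pair n i)))) ↔
        (F c (Nat.pair (Nat.pair n i) m)).Dom := by
      rw [← hc, ← Code.eval_curry, W, ← hψg, stdNumbering, ofNat_encode]
      rfl
    rw [hdom]
    refine Nat.rfind_dom.trans ?_
    rw [Set.mem_range]
    constructor
    · rintro ⟨k, hk, -⟩
      have hk := (Part.mem_some_iff.1 hk).symm
      simp only [Nat.unpair_pair, Bool.and_eq_true, decide_eq_true_eq] at hk
      exact ⟨⟨_, hk.1⟩, ⟨_, hk.2.symm⟩⟩
    · rintro ⟨⟨y, hy⟩, ⟨j, hj⟩⟩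
      exact ⟨Nat.pair y j, Part.mem_some_iff.2 (by simp [hy, hj]), fun _ => trivial⟩

theorem IsPi02.manyOneReducible_S {ψ : ℕ → ℕ →. ℕ} (hψ : IsAcceptable ψ) {B : Set ℕ}
    (hB : IsPi02 B) : ManyOneReducible (fun n => n ∈ B) (fun e => e ∈ S ψ) := by
  obtain ⟨R, hR, hB⟩ := hB.exists_bool
  -- Index `0` passes unconditionally; index `x + 1` tests `R` at `x`.
  let Q : ℕ × ℕ × ℕ → Bool := fun q => decide (q.2.1 = 0) || R (q.1, q.2.1 - 1, q.2.2)
  have hQ : Computable Q := by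
    have hi : Computable fun q : ℕ × ℕ × ℕ => q.2.1 := Computable.fst.comp Computable.snd
    exact Primrec.or.to_comp.comp
      ((Primrec.eq (α := ℕ)).decide.to_comp.comp hi (Computable.const 0))
      (hR.comp (Computable.fst.pair
        ((Primrec.pred.to_comp.comp hi).pair (Computable.snd.comp Computable.snd))))
  obtain ⟨p, hp, hW⟩ := hψ.exists_indices hQ
  have hzero (n : ℕ) : W ψ (p n 0) = Set.range (p n) := by
    ext m
    simp [hW, Q]
  refine ⟨fun n => p n 0, hp.comp Computable.id (Computable.const 0), fun n => ?_⟩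
  change n ∈ B ↔ p n 0 ∈ S ψ
  rw [hB, mem_S_iff hψ, hzero]
  constructor
  · refine fun h => ⟨Set.range_nonempty _, ?_⟩
    rintro _ ⟨i, rfl⟩
    ext m
    rw [hW, and_iff_right]
    cases i with
    | zero => exact ⟨0, by simp [Q]⟩
    | succ x => exact (h x).imp fun y hy => by simpa [Q] using hy
  · rintro ⟨-, h⟩ x
    -- Self-construction makes this set nonempty, which forces its condition to hold.
    have hx : p n 0 ∈ W ψ (p n (x + 1)) := by
      rw [h _ ⟨x + 1, rfl⟩]
      exact ⟨0, rfl⟩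
    simpa [Q] using ((hW _ _ _).1 hx).1

end SelfConstructing

theorem mainTheorem7 (ψ : ℕ → ℕ →. ℕ) (hψ : SelfConstructing.IsAcceptable ψ) :
    SelfConstructing.IsPi02Complete (SelfConstructing.S ψ) ∧
      ManyOneReducible (fun e => e ∈ SelfConstructing.Tot ψ)
        (fun e => e ∈ SelfConstructing.S ψ) :=
  ⟨⟨SelfConstructing.isPi02_S hψ, fun _ hB => hB.manyOneReducible_S hψ⟩,
    (SelfConstructing.isPi02_Tot hψ).manyOneReducible_S hψ⟩
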